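/- **Setting.** Fix a vocabulary of predicates (with arities) and constants, and an infinite set of variables; terms are constants and variables. A *fact base*, and likewise a (Boolean) *conjunctive query* (CQ), is a finite set of atoms, read as an existentially closed conjunction. A *UCQ* is a finite set of CQs; any set of CQs, finite or not, is read as the disjunction of its elements. A *disjunctive existential rule* is $R = B \rightarrow H_1\lor\dots\lor H_n$ with $n\ge 1$, where $B, H_1,\dots,H_n$ are non-empty finite sets of atoms; the variables of $B$ are universally quantified, and the variables of $H_i$ that do not occur in $B$ are existentially quantified in $H_i$ and occur in no other $H_j$. $\models$ and $\equiv$ denote classical logical entailment and equivalence. **Rewritings.** A *rewriting* of $(\mathcal Q,\mathcal R)$ is a possibly infinite set $\mathcal Q'$ of CQs such that, for every fact base $F$, $F\models\mathcal Q'$ implies $F,\mathcal R\models\mathcal Q$. It is *complete* if, for every fact base $F$, $F,\mathcal R\models\mathcal Q$ implies $F\models\mathcal Q'$. A *UCQ-rewriting* is a finite complete rewriting. **Piece-unifiers.** A partition of a set of terms is *admissible* if no class contains two distinct constants; a substitution is *associated* with it if it maps all the terms of each class to one selected term of the class (the constant, if there is one), and is the identity elsewhere. A *piece-unifier* of a CQ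 $Q$ with $B\rightarrow H$ (sharing no variable with $Q$) is a triple $(Q',H',P)$ with $\emptyset\ne Q'\subseteq Q$, $H'\subseteq H$ and $P$ an admissible partition of the terms of $Q'\cup H'$, such that $u(Q')=u(H')$ for an associated substitution $u$, and such that, if a class contains an existential variable of $H'$, then all its other terms are variables of $Q'$ that do not occur in $Q\setminus Q'$. A *disjunctive piece-unifier* $\mu$ of a set $\mathcal Q$ of CQs with $R$ consists of piece-unifiers $(Q_i',H_i',P_i)$ of $Q_i$ with $B\rightarrow H_i$ for $1\le i\le n$, where the $Q_i$ are copies of CQs from $\mathcal Q$, obtained by bijective renaming of variables, that share no variables with each other or with $R$, and where the join of $P_1,\dots,P_n$ (the partition obtained from their union by merging non-disjoint classes until a fixed point is reached) is admissible. For a substitution $u$ associated with the join, $\mu$ produces the CQ $\beta(\mathcal Q,R,\mu)=u(B)\cup\bigcup_{i} u(Q_i\setminus Q_i')$. **Breadth-first operator.** Let $W_0(\mathcal Q,\mathcal R)=\mathcal Q$; let $W_{i+1}(\mathcal Q,\mathcal R)$ be the union of $W_i(\mathcal Q,\mathcal R)$ and the set of all CQs $\beta(W_i(\mathcal Q,\mathcal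 R),R,\mu)$ with $R\in\mathcal R$ and $\mu$ a disjunctive piece-unifier of $W_i(\mathcal Q,\mathcal R)$ with $R$; and let $W(\mathcal Q,\mathcal R)=\bigcup_{i\in\mathbb N}W_i(\mathcal Q,\mathcal R)$. **Proposition (properties of $W$).** For every UCQ $\mathcal Q$ and every set $\mathcal R$ of disjunctive existential rules: 1. $W(\mathcal Q,\mathcal R)$ is a complete rewriting of $(\mathcal Q,\mathcal R)$. 2. For every UCQ-rewriting $\mathcal Q'$ of $(\mathcal Q,\mathcal R)$ there is $i\ge 0$ such that $\mathcal Q'\equiv W_i(\mathcal Q,\mathcal R)$. -/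

import Mathlib

universe u v w

/-- A logical vocabulary: predicates with their arities, and constants. -/
structure Vocabulary where
  /-- the predicate symbols -/
  Pred : Type u
  /-- the arity of each predicate symbol -/
  arity : Pred → ℕ
  /-- the constant symbols -/
  Const : Type v

namespace DisjRewriting

/-- A term is a constant of the vocabulary or a variable from `X`. -/
inductive Term (𝒱 : Vocabulary.{u, v}) (X : Type w) : Type (max v w)
  | const (c : 𝒱.Const) : Term 𝒱 X
  | var (x : X) : Term 𝒱 X

/-- An atom `p(t₁, …, tₖ)`, with `k` the arity of `p`. -/
structure Atom (𝒱 : Vocabulary.{u, v}) (X : Type w) : Type (max u v w) where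
  /-- the predicate of the atom -/
  pred : 𝒱.Pred
  /-- the tuple of terms of the atom -/
  args : Fin (𝒱.arity pred) → Term 𝒱 X

section Syntactic

variable {𝒱 : Vocabulary.{u, v}} {X : Type w}

/-- The set of terms that occur in a set of atoms. -/
def terms (S : Set (Atom 𝒱 X)) : Set (Term 𝒱 X) :=
  {t | ∃ a ∈ S, ∃ k, a.args k = t}

/-- The set of variables that occur in a set of atoms. -/
def vars (S : Set (Atom 𝒱 X)) : Set X :=
  {x | Term.var x ∈ terms S}

/-- The image of a term under a substitution of the variables; constants are fixed. -/
def Term.subst (σ : X → Term 𝒱 X) : Term 𝒱 X → Term 𝒱 X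
  | .const c => .const c
  | .var x => σ x

/-- The image of an atom under a substitution. -/
def Atom.subst (σ : X → Term 𝒱 X) (a : Atom 𝒱 X) : Atom 𝒱 X :=
  ⟨a.pred, fun k => (a.args k).subst σ⟩

/-- The image `σ(S)` of a set of atoms under a substitution. -/
def substSet (σ : X → Term 𝒱 X) (S : Set (Atom 𝒱 X)) : Set (Atom 𝒱 X) :=
  Atom.subst σ '' S

/-- `S'` is obtained from `S` by a bijective renaming of the variables of `S`. -/
def IsCopy (S S' : Set (Atom 𝒱 X)) : Prop :=
  ∃ ρ : X → X, Set.InjOn ρ (vars S) ∧ S' = substSet (fun x => Term.var (ρ x)) S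

/-- A union of (Boolean) conjunctive queries: a finite set of finite sets of atoms. A Boolean
conjunctive query is a finite set of atoms, read as an existentially closed conjunction. -/
def IsUCQ (𝒬 : Set (Set (Atom 𝒱 X))) : Prop :=
  𝒬.Finite ∧ ∀ Q ∈ 𝒬, Q.Finite

end Syntactic

/-- A disjunctive existential rule `B → H₁ ∨ … ∨ Hₙ`, with `n ≥ 1`. The variables of `Hᵢ` that occur
in `B` are frontier variables, universally quantified; the others are the existential variables
of `Hᵢ`. Distinct disjuncts have disjoint sets of existential variables. -/
structure Rule (𝒱 : Vocabulary.{u, v}) (X : Type w) : Type (max u v w) where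
  /-- the number of disjuncts of the head -/
  n : ℕ
  /-- the body `B` -/
  body : Set (Atom 𝒱 X)
  /-- the disjuncts `Hᵢ` of the head -/
  head : Fin n → Set (Atom 𝒱 X)
  n_pos : 0 < n
  body_finite : body.Finite
  body_nonempty : body.Nonempty
  head_finite : ∀ i, (head i).Finite
  head_nonempty : ∀ i, (head i).Nonempty
  exist_disjoint : ∀ i j, i ≠ j →
    Disjoint (vars (head i) \ vars body) (vars (head j) \ vars body)

/-- All the variables of a rule. -/
def Rule.vars {𝒱 : Vocabulary.{u, v}} {X : Type w} (R : Rule 𝒱 X) : Set X :=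
  DisjRewriting.vars R.body ∪ ⋃ i, DisjRewriting.vars (R.head i)

/-! ### Semantics -/

/-- A first-order interpretation of the vocabulary, with non-empty domain. -/
structure Interp (𝒱 : Vocabulary.{u, v}) where
  /-- the domain -/
  Dom : Type w
  nonempty : Nonempty Dom
  /-- the interpretation of the constants -/
  const : 𝒱.Const → Dom
  /-- the interpretation of the predicates -/
  rel : (p : 𝒱.Pred) → (Fin (𝒱.arity p) → Dom) → Prop

section Semantics

variable {𝒱 : Vocabulary.{u, v}} {X : Type w}

/-- The value of a term under an assignment of the variables. -/
def Interp.eval (I : Interp 𝒱) (ν : X → I.Dom) : Term 𝒱 X → I.Dom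
  | .const c => I.const c
  | .var x => ν x

/-- The atom `a` is true in `I` under the assignment `ν`. -/
def Interp.Holds (I : Interp 𝒱) (ν : X → I.Dom) (a : Atom 𝒱 X) : Prop :=
  I.rel a.pred fun k => I.eval ν (a.args k)

/-- `I` is a model of the set of atoms `S`, read as an existentially closed conjunction. -/
def Interp.SatConj (I : Interp 𝒱) (S : Set (Atom 𝒱 X)) : Prop :=
  ∃ ν : X → I.Dom, ∀ a ∈ S, I.Holds ν a

/-- `I` is a model of the (possibly infinite) set `𝒬` of conjunctive queries, read as the
disjunction of its elements. -/
def Interp.SatUnion (I : Interp 𝒱) (𝒬 : Set (Set (Atom 𝒱 X))) : Prop :=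
  ∃ Q ∈ 𝒬, I.SatConj Q

/-- `I` is a model of the rule `R`. -/
def Interp.SatRule (I : Interp 𝒱) (R : Rule 𝒱 X) : Prop :=
  ∀ ν : X → I.Dom, (∀ a ∈ R.body, I.Holds ν a) →
    ∃ i, ∃ ν' : X → I.Dom, (∀ x ∈ vars R.body, ν' x = ν x) ∧ ∀ a ∈ R.head i, I.Holds ν' a

/-- `F ⊨ 𝒬`: logical entailment of a set of conjunctive queries by a set of facts. -/
def Entails (F : Set (Atom 𝒱 X)) (𝒬 : Set (Set (Atom 𝒱 X))) : Prop :=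
  ∀ I : Interp.{u, v, max u v w} 𝒱, I.SatConj F → I.SatUnion 𝒬

/-- `F, ℛ ⊨ 𝒬`: logical entailment by a knowledge base. -/
def KBEntails (F : Set (Atom 𝒱 X)) (ℛ : Set (Rule 𝒱 X)) (𝒬 : Set (Set (Atom 𝒱 X))) : Prop :=
  ∀ I : Interp.{u, v, max u v w} 𝒱, I.SatConj F → (∀ R ∈ ℛ, I.SatRule R) → I.SatUnion 𝒬

/-- `𝒬₁ ≡ 𝒬₂`: logical equivalence of sets of conjunctive queries. -/
def Equivalent (𝒬₁ 𝒬₂ : Set (Set (Atom 𝒱 X))) : Prop :=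
  ∀ I : Interp.{u, v, max u v w} 𝒱, I.SatUnion 𝒬₁ ↔ I.SatUnion 𝒬₂

/-- `𝒬'` is a (sound) rewriting of `(𝒬, ℛ)`: a possibly infinite set of conjunctive queries such
that every fact base that entails `𝒬'` entails `𝒬` together with `ℛ`. -/
def IsRewriting (𝒬' 𝒬 : Set (Set (Atom 𝒱 X))) (ℛ : Set (Rule 𝒱 X)) : Prop :=
  (∀ Q ∈ 𝒬', Q.Finite) ∧
    ∀ F : Set (Atom 𝒱 X), F.Finite → Entails F 𝒬' → KBEntails F ℛ 𝒬

/-- A complete (and sound) rewriting. -/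
def IsCompleteRewriting (𝒬' 𝒬 : Set (Set (Atom 𝒱 X))) (ℛ : Set (Rule 𝒱 X)) : Prop :=
  IsRewriting 𝒬' 𝒬 ℛ ∧
    ∀ F : Set (Atom 𝒱 X), F.Finite → KBEntails F ℛ 𝒬 → Entails F 𝒬'

/-- A UCQ-rewriting: a finite complete rewriting. -/
def IsUCQRewriting (𝒬' 𝒬 : Set (Set (Atom 𝒱 X))) (ℛ : Set (Rule 𝒱 X)) : Prop :=
  𝒬'.Finite ∧ IsCompleteRewriting 𝒬' 𝒬 ℛ

end Semantics

/-! ### Piece-unifiers -/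

section Partitions

variable {𝒱 : Vocabulary.{u, v}} {X : Type w}

/-- Two elements are joined by a family of partitions if a finite chain of elements leads from one
to the other, consecutive elements being in a common class of one of the partitions. -/
def JoinRel {α ι : Type*} {T : ι → Set α} (P : ∀ i, Partition (T i)) : α → α → Prop :=
  Relation.TransGen fun s t => ∃ i, (P i).Rel s t

theorem JoinRel.symm {α ι : Type*} {T : ι → Set α} {P : ∀ i, Partition (T i)} {s t : α}
    (h : JoinRel P s t) : JoinRel P t s := by
  induction h with
  | single h => exact .single (h.imp fun _ h => h.symm)
  | tail _ h ih => exact .head (h.imp fun _ h => h.symm) ih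

/-- The join of a family of partitions of the sets `T i`: the partition of the union of the `T i`
obtained by merging non-disjoint classes until a fixed point is reached. -/
def join {α ι : Type*} {T : ι → Set α} (P : ∀ i, Partition (T i)) : Partition (⋃ i, T i) where
  parts := {C | ∃ t ∈ ⋃ i, T i, C = {s | JoinRel P t s}}
  sSupIndep' := by
    rw [sSupIndep_iff_pairwiseDisjoint]
    rintro _ ⟨t, -, rfl⟩ _ ⟨t', -, rfl⟩ hne
    refine Set.disjoint_left.2 fun s hs hs' => hne ?_
    have htt' : JoinRel P t t' := Relation.TransGen.trans hs (JoinRel.symm hs')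
    ext r
    exact ⟨fun h => Relation.TransGen.trans htt'.symm h, fun h => Relation.TransGen.trans htt' h⟩
  bot_notMem' := by
    rintro ⟨t, ht, h⟩
    obtain ⟨i, hi⟩ := Set.mem_iUnion.1 ht
    have : t ∈ (∅ : Set α) := by
      rw [← Set.bot_eq_empty, h]
      exact .single ⟨i, (P i).rel_rfl_iff.2 hi⟩
    exact this
  sSup_eq' := by
    ext s
    constructor
    · rintro ⟨_, ⟨t, -, rfl⟩, hs⟩
      obtain ⟨r, ⟨i, hi⟩, -⟩ := Relation.TransGen.head'_iff.1 (JoinRel.symm hs)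
      exact Set.mem_iUnion.2 ⟨i, hi.left_mem⟩
    · intro hs
      obtain ⟨i, hi⟩ := Set.mem_iUnion.1 hs
      exact ⟨_, ⟨s, hs, rfl⟩, .single ⟨i, (P i).rel_rfl_iff.2 hi⟩⟩

/-- A partition of a set of terms is admissible if no class contains two constants. -/
def IsAdmissible {T : Set (Term 𝒱 X)} (P : Partition T) : Prop :=
  ∀ C ∈ P, ∀ a b, Term.const a ∈ C → Term.const b ∈ C → a = b

/-- The substitution `σ` is associated with the partition `P`: it maps all the terms of a class to
one selected term of the class, and is the identity outside the partitioned set. As a substitution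
fixes constants, the selected term of a class with a constant is this constant. -/
def IsAssociated {T : Set (Term 𝒱 X)} (P : Partition T) (σ : X → Term 𝒱 X) : Prop :=
  P.IsRepFun (Term.subst σ)

end Partitions

section Unifiers

variable {𝒱 : Vocabulary.{u, v}} {X : Type w}

/-- A piece-unifier `(Q', H', P)` of the conjunctive query `Q` with the conjunctive rule `B → H`. -/
structure PieceUnifier (Q B H : Set (Atom 𝒱 X)) where
  /-- the unified part of the query -/
  Q' : Set (Atom 𝒱 X)
  /-- the unified part of the head -/
  H' : Set (Atom 𝒱 X)
  /-- the partition that describes the unifier -/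
  P : Partition (terms Q' ∪ terms H')
  vars_disjoint : Disjoint (vars Q) (vars (B ∪ H))
  Q'_nonempty : Q'.Nonempty
  Q'_subset : Q' ⊆ Q
  H'_subset : H' ⊆ H
  admissible : IsAdmissible P
  unifies : ∃ σ : X → Term 𝒱 X, IsAssociated P σ ∧ substSet σ Q' = substSet σ H'
  /-- the terms in the class of an existential variable, other than this variable, are
  non-separating variables of `Q'` -/
  existential : ∀ C ∈ P, ∀ z ∈ vars H' \ vars B, Term.var z ∈ C → ∀ t ∈ C, t ≠ Term.var z →
    ∃ x ∈ vars Q' \ vars (Q \ Q'), t = Term.var x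

/-- A disjunctive piece-unifier of the set `𝒬` of conjunctive queries with the rule `R`: a
piece-unifier for each disjunct of the head with a safe copy of an element of `𝒬`, such that the
join of the partitions is admissible. -/
structure DisjPieceUnifier (𝒬 : Set (Set (Atom 𝒱 X))) (R : Rule 𝒱 X) where
  /-- the safe copies -/
  copy : Fin R.n → Set (Atom 𝒱 X)
  isCopy : ∀ i, ∃ Q ∈ 𝒬, IsCopy Q (copy i)
  copy_disjoint_rule : ∀ i, Disjoint (vars (copy i)) R.vars
  copy_disjoint : ∀ i j, i ≠ j → Disjoint (vars (copy i)) (vars (copy j))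
  /-- the piece-unifiers -/
  unifier : ∀ i, PieceUnifier (copy i) R.body (R.head i)
  admissible : IsAdmissible (join fun i => (unifier i).P)

/-- The conjunctive query produced by a disjunctive piece-unifier and a substitution `σ` (meant to
be associated with the join of the partitions). -/
def DisjPieceUnifier.produce {𝒬 : Set (Set (Atom 𝒱 X))} {R : Rule 𝒱 X}
    (μ : DisjPieceUnifier 𝒬 R) (σ : X → Term 𝒱 X) : Set (Atom 𝒱 X) :=
  substSet σ R.body ∪ ⋃ i, substSet σ (μ.copy i \ (μ.unifier i).Q')

/-- All the conjunctive queries produced by a disjunctive piece-unifier of `𝒬` with a rule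
from `ℛ` and a substitution associated with the join of its partitions. -/
def produced (𝒬 : Set (Set (Atom 𝒱 X))) (ℛ : Set (Rule 𝒱 X)) : Set (Set (Atom 𝒱 X)) :=
  {C | ∃ R ∈ ℛ, ∃ μ : DisjPieceUnifier 𝒬 R, ∃ σ : X → Term 𝒱 X,
    IsAssociated (join fun i => (μ.unifier i).P) σ ∧ C = μ.produce σ}

/-- The levels `W_i(𝒬, ℛ)` of the breadth-first rewriting operator. -/
def level (𝒬 : Set (Set (Atom 𝒱 X))) (ℛ : Set (Rule 𝒱 X)) : ℕ → Set (Set (Atom 𝒱 X))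
  | 0 => 𝒬
  | i + 1 => level 𝒬 ℛ i ∪ produced (level 𝒬 ℛ i) ℛ

/-- The breadth-first rewriting operator `W(𝒬, ℛ)`. -/
def W (𝒬 : Set (Set (Atom 𝒱 X))) (ℛ : Set (Rule 𝒱 X)) : Set (Set (Atom 𝒱 X)) :=
  ⋃ i, level 𝒬 ℛ i

end Unifiers

end DisjRewriting

/-! Soundness is a single backward step. Let a model of the rules satisfy a produced CQ `u(B) ∪ ⋃
u(Qᵢ \ Qᵢ')`. Composing the match with `u` gives a match of `B`, so the rule supplies some disjunct
`Hᵢ`. Moving the variables of `Qᵢ'` that are unified with existential variables onto the supplied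
witnesses turns this into a match of all of `Qᵢ` (`PieceUnifier.satConj`).

Completeness replaces the chase by a maximality argument. Suppose no query of `W` matches the facts
of `F`. Over a domain with a null for each existential variable of each head instance, Zorn's lemma
gives a maximal set of facts `A ⊇ F` that no query of `W` matches and in which a null occurs only
together with the whole head instance introducing it. If a rule failed in `A`, adding any one of its
head instances would create a match, by maximality. The nulls of that instance are fresh for `A`, so
these matches, one per disjunct, yield a disjunctive piece-unifier whose product matches in `A`
itself (`exists_match_of_forall_head`), a contradiction. So `A` is a model of `F` and the rules in
which the original queries fail.

For a UCQ-rewriting, each of its finitely many CQs entails a single CQ of `W`, and finitely many CQs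
of `W` lie in a common level. -/

namespace DisjRewriting

/-! ### Associated substitutions, kernels of maps and joins of partitions. -/

section Partitions

/-- Admissibility makes the identity on constants a consistent partial choice of representatives.
Any extension of it fixes the constants, hence is a substitution. -/
theorem IsAdmissible.exists_isAssociated {𝒱 : Vocabulary.{u, v}} {X : Type w}
    {T : Set (Term 𝒱 X)} {P : Partition T} (hP : IsAdmissible P) :
    ∃ σ : X → Term 𝒱 X, IsAssociated P σ := by
  obtain ⟨f, hf, hfc⟩ := Partition.IsRepFun.exists_extend_partial'
    (t := Set.range (Term.const : 𝒱.Const → Term 𝒱 X)) P (by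
      rintro _ _ ⟨a, rfl⟩ ⟨b, rfl⟩ ⟨C, hC, ha, hb⟩
      rw [hP C hC a b ha hb])
  refine ⟨fun x => f (.var x), ?_⟩
  have : Term.subst (fun x => f (.var x)) = f := by
    funext t
    cases t with
    | const c => exact (hfc ⟨c, rfl⟩).symm
    | var x => rfl
  rwa [IsAssociated, this]

/-- The partition of `T` into the fibres of `f`. -/
def kernelPartition {α β : Type*} (f : α → β) (T : Set α) : Partition T where
  parts := {C | ∃ t ∈ T, C = {s | s ∈ T ∧ f s = f t}}
  sSupIndep' := by
    rw [sSupIndep_iff_pairwiseDisjoint]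
    rintro _ ⟨t, -, rfl⟩ _ ⟨t', -, rfl⟩ hne
    refine Set.disjoint_left.2 fun s hs hs' => hne ?_
    have : f t = f t' := hs.2.symm.trans hs'.2
    simp [this]
  bot_notMem' := by
    rintro ⟨t, ht, h⟩
    have : t ∈ (∅ : Set α) := by
      rw [← Set.bot_eq_empty, h]
      exact ⟨ht, rfl⟩
    exact this
  sSup_eq' := by
    ext s
    constructor
    · rintro ⟨_, ⟨t, -, rfl⟩, hs⟩
      exact hs.1
    · intro hs
      exact ⟨_, ⟨s, hs, rfl⟩, hs, rfl⟩

theorem kernelPartition_rel {α β : Type*} {f : α → β} {T : Set α} {s t : α} :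
    (kernelPartition f T).Rel s t ↔ s ∈ T ∧ t ∈ T ∧ f s = f t := by
  constructor
  · rintro ⟨_, ⟨r, -, rfl⟩, hs, ht⟩
    exact ⟨hs.1, ht.1, hs.2.trans ht.2.symm⟩
  · rintro ⟨hs, ht, h⟩
    exact ⟨_, ⟨t, ht, rfl⟩, ⟨hs, h⟩, ht, rfl⟩

theorem join_rel {α ι : Type*} {T : ι → Set α} {P : ∀ i, Partition (T i)} {s t : α} :
    (join P).Rel s t ↔ JoinRel P s t := by
  constructor
  · rintro ⟨_, ⟨r, -, rfl⟩, hs, ht⟩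
    exact Relation.TransGen.trans (JoinRel.symm hs) ht
  · intro h
    obtain ⟨r, ⟨i, hi⟩, -⟩ := Relation.TransGen.head'_iff.1 h
    exact ⟨_, ⟨s, Set.mem_iUnion.2 ⟨i, hi.left_mem⟩, rfl⟩, .single ⟨i, (P i).rel_rfl_iff.2
      hi.left_mem⟩, h⟩

theorem JoinRel.eq_of_forall {α β ι : Type*} {T : ι → Set α} {P : ∀ i, Partition (T i)}
    {f : α → β} (hf : ∀ i s t, (P i).Rel s t → f s = f t) {s t : α} (h : JoinRel P s t) :
    f s = f t := by
  induction h with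
  | single h => exact hf _ _ _ h.choose_spec
  | tail _ h ih => exact ih.trans (hf _ _ _ h.choose_spec)

end Partitions

/-! ### Facts over an arbitrary domain, copies of queries, gluing of assignments. -/

section Facts

variable {𝒱 : Vocabulary.{u, v}} {X : Type w} {D : Type*}

/-- The value of a term, for an interpretation `c` of the constants and an assignment `ν` of the
variables. -/
def Term.val (c : 𝒱.Const → D) (ν : X → D) : Term 𝒱 X → D
  | .const a => c a
  | .var x => ν x

/-- A predicate with a tuple of elements of a domain. -/
abbrev Fact (𝒱 : Vocabulary.{u, v}) (D : Type*) := (p : 𝒱.Pred) × (Fin (𝒱.arity p) → D)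

/-- The fact that an atom expresses under an assignment of the variables. -/
def Atom.fact (c : 𝒱.Const → D) (ν : X → D) (a : Atom 𝒱 X) : Fact 𝒱 D :=
  ⟨a.pred, fun k => (a.args k).val c ν⟩

/-- The interpretation in which exactly the facts of `A` are true. -/
def factInterp [Nonempty D] (c : 𝒱.Const → D) (A : Set (Fact 𝒱 D)) : Interp 𝒱 where
  Dom := D
  nonempty := inferInstance
  const := c
  rel p v := ⟨p, v⟩ ∈ A

theorem factInterp_holds [Nonempty D] {c : 𝒱.Const → D} {A : Set (Fact 𝒱 D)} {ν : X → D}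
    {a : Atom 𝒱 X} : (factInterp c A).Holds ν a ↔ a.fact c ν ∈ A := by
  have : ∀ t : Term 𝒱 X, (factInterp c A).eval ν t = t.val c ν := by
    rintro (_ | _) <;> rfl
  simp only [Interp.Holds, this]
  rfl

theorem Term.val_subst (c : 𝒱.Const → D) (ν : X → D) (σ : X → Term 𝒱 X) (t : Term 𝒱 X) :
    (t.subst σ).val c ν = t.val c fun x => (σ x).val c ν := by
  cases t <;> rfl

theorem Atom.fact_subst (c : 𝒱.Const → D) (ν : X → D) (σ : X → Term 𝒱 X) (a : Atom 𝒱 X) :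
    (a.subst σ).fact c ν = a.fact c fun x => (σ x).val c ν := by
  simp [Atom.fact, Atom.subst, Term.val_subst]

theorem Atom.fact_congr {c : 𝒱.Const → D} {ν ν' : X → D} {S : Set (Atom 𝒱 X)} {a : Atom 𝒱 X}
    (ha : a ∈ S) (h : ∀ x ∈ vars S, ν x = ν' x) : a.fact c ν = a.fact c ν' := by
  have : ∀ k, (a.args k).val c ν = (a.args k).val c ν' := by
    intro k
    cases hk : a.args k with
    | const b => rfl
    | var x => exact h x ⟨a, ha, k, hk⟩
  simp [Atom.fact, this]

theorem terms_finite {S : Set (Atom 𝒱 X)} (hS : S.Finite) : (terms S).Finite := by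
  have : terms S = ⋃ a ∈ S, Set.range a.args := by
    ext t
    simp [terms]
  rw [this]
  exact hS.biUnion fun a _ => Set.finite_range _

theorem vars_finite {S : Set (Atom 𝒱 X)} (hS : S.Finite) : (vars S).Finite :=
  (terms_finite hS).preimage fun _ _ _ _ h => Term.var.inj h

theorem vars_mono {S T : Set (Atom 𝒱 X)} (h : S ⊆ T) : vars S ⊆ vars T :=
  fun _ ⟨a, ha, k, hk⟩ => ⟨a, h ha, k, hk⟩

theorem Rule.vars_finite (R : Rule 𝒱 X) : R.vars.Finite :=
  (DisjRewriting.vars_finite R.body_finite).union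
    (Set.finite_iUnion fun i => DisjRewriting.vars_finite (R.head_finite i))

theorem vars_substSet_var {S : Set (Atom 𝒱 X)} {ρ : X → X} {y : X}
    (hy : y ∈ vars (substSet (fun x => Term.var (ρ x)) S)) : ∃ x ∈ vars S, ρ x = y := by
  obtain ⟨_, ⟨a, ha, rfl⟩, k, hk⟩ := hy
  change (a.args k).subst _ = _ at hk
  cases hak : a.args k with
  | const b => simp [hak, Term.subst] at hk
  | var x => exact ⟨x, ⟨a, ha, k, hak⟩, by simpa [hak, Term.subst] using hk⟩

/-- A match of a set of atoms is also a match of its copies. -/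
theorem IsCopy.exists_assignment {Q Q' : Set (Atom 𝒱 X)} (h : IsCopy Q Q') (c : 𝒱.Const → D)
    (μ : X → D) : ∃ μ' : X → D, ∀ a' ∈ Q', ∃ a ∈ Q, a'.fact c μ' = a.fact c μ := by
  classical
  obtain ⟨ρ, hρ, rfl⟩ := h
  rcases isEmpty_or_nonempty X with hX | hX
  · refine ⟨μ, ?_⟩
    rintro _ ⟨a, ha, rfl⟩
    refine ⟨a, ha, ?_⟩
    rw [Atom.fact_subst]
    exact Atom.fact_congr ha fun x => hX.elim x
  -- The renaming is injective on the variables of `Q`, so the match is pulled back along its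
  -- inverse.
  refine ⟨fun y => μ (Function.invFunOn ρ (vars Q) y), ?_⟩
  rintro _ ⟨a, ha, rfl⟩
  refine ⟨a, ha, ?_⟩
  rw [Atom.fact_subst]
  refine Atom.fact_congr ha fun x hx => ?_
  simp [Term.val, hρ.leftInvOn_invFunOn hx]

theorem IsCopy.satConj {Q Q' : Set (Atom 𝒱 X)} (h : IsCopy Q Q') {I : Interp 𝒱}
    (hI : I.SatConj Q') : I.SatConj Q := by
  obtain ⟨ρ, -, rfl⟩ := h
  obtain ⟨ν, hν⟩ := hI
  refine ⟨fun x => ν (ρ x), fun a ha => ?_⟩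
  have := hν _ ⟨a, ha, rfl⟩
  have e : ∀ t : Term 𝒱 X, I.eval ν (t.subst fun x => Term.var (ρ x)) =
      I.eval (fun x => ν (ρ x)) t := by
    rintro (_ | _) <;> rfl
  simpa [Interp.Holds, Atom.subst, e] using this

/-- Finitely many finite sets of atoms have copies that share no variables with each other and
avoid a given finite set of variables. -/
theorem exists_copies [Infinite X] {n : ℕ} (Q : Fin n → Set (Atom 𝒱 X)) (hQ : ∀ i, (Q i).Finite)
    {S : Set X} (hS : S.Finite) :
    ∃ Q' : Fin n → Set (Atom 𝒱 X), (∀ i, IsCopy (Q i) (Q' i)) ∧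
      (∀ i, Disjoint (vars (Q' i)) S) ∧ ∀ i j, i ≠ j → Disjoint (vars (Q' i)) (vars (Q' j)) := by
  classical
  have : ∀ i, Finite (vars (Q i)) := fun i => vars_finite (hQ i)
  have : Infinite ↥Sᶜ := hS.infinite_compl.to_subtype
  obtain ⟨m, ⟨e⟩⟩ := Finite.exists_equiv_fin (Σ i, vars (Q i))
  let g : (Σ i, vars (Q i)) ↪ ↥Sᶜ :=
    (e.toEmbedding.trans Fin.valEmbedding).trans (Infinite.natEmbedding _)
  let ρ : Fin n → X → X := fun i x => if hx : x ∈ vars (Q i) then (g ⟨i, x, hx⟩ : X) else x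
  have hρ : ∀ i x (hx : x ∈ vars (Q i)), ρ i x = g ⟨i, x, hx⟩ := fun i x hx => dif_pos hx
  refine ⟨fun i => substSet (fun x => Term.var (ρ i x)) (Q i), fun i => ⟨ρ i, ?_, rfl⟩, ?_, ?_⟩
  · intro x hx y hy hxy
    rw [hρ i x hx, hρ i y hy] at hxy
    have := g.injective (Subtype.ext hxy)
    simpa using this
  · intro i
    refine Set.disjoint_left.2 fun y hy hyS => ?_
    obtain ⟨x, hx, rfl⟩ := vars_substSet_var hy
    rw [hρ i x hx] at hyS
    exact (g ⟨i, x, hx⟩).2 hyS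
  · intro i j hij
    refine Set.disjoint_left.2 fun y hy hy' => ?_
    obtain ⟨x, hx, rfl⟩ := vars_substSet_var hy
    obtain ⟨x', hx', h⟩ := vars_substSet_var hy'
    rw [hρ i x hx, hρ j x' hx'] at h
    have := g.injective (Subtype.ext h)
    exact hij (Sigma.mk.inj this).1.symm

theorem exists_glue {ι α β : Type*} [Nonempty β] (S : ι → Set α) (g : ι → α → β)
    (h : ∀ i j x, x ∈ S i → x ∈ S j → g i x = g j x) : ∃ f : α → β, ∀ i, ∀ x ∈ S i, f x = g i x := by
  classical
  refine ⟨fun x => if hx : ∃ i, x ∈ S i then g hx.choose x else Classical.arbitrary β,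
    fun i x hx => ?_⟩
  have hx' : ∃ i, x ∈ S i := ⟨i, hx⟩
  simp only [dif_pos hx']
  exact h _ _ _ hx'.choose_spec hx

end Facts

/-! ### Soundness of the rewriting step. -/

section Soundness

variable {𝒱 : Vocabulary.{u, v}} {X : Type w}

theorem Interp.eval_subst (I : Interp 𝒱) (ν : X → I.Dom) (σ : X → Term 𝒱 X) (t : Term 𝒱 X) :
    I.eval ν (t.subst σ) = I.eval (fun x => I.eval ν (σ x)) t := by
  cases t <;> rfl

theorem Interp.holds_subst (I : Interp 𝒱) (ν : X → I.Dom) (σ : X → Term 𝒱 X) (a : Atom 𝒱 X) :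
    I.Holds ν (a.subst σ) ↔ I.Holds (fun x => I.eval ν (σ x)) a := by
  simp [Interp.Holds, Atom.subst, Interp.eval_subst]

theorem Interp.Holds.congr {I : Interp 𝒱} {ν ν' : X → I.Dom} {S : Set (Atom 𝒱 X)} {a : Atom 𝒱 X}
    (ha : a ∈ S) (h : ∀ x ∈ vars S, ν x = ν' x) (H : I.Holds ν a) : I.Holds ν' a := by
  have : ∀ k, I.eval ν (a.args k) = I.eval ν' (a.args k) := by
    intro k
    cases hk : a.args k with
    | const b => rfl
    | var x => exact h x ⟨a, ha, k, hk⟩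
  simpa [Interp.Holds, this] using H

/-- A model of a disjunct of a head, under an assignment that agrees on the frontier with a model
of the remaining part of a query, is a model of the whole query. -/
theorem PieceUnifier.satConj {Q B H : Set (Atom 𝒱 X)} (U : PieceUnifier Q B H) {I : Interp 𝒱}
    {ν ν' : X → I.Dom} (hP : ∀ s t, U.P.Rel s t → I.eval ν s = I.eval ν t)
    (hQ : ∀ a ∈ Q \ U.Q', I.Holds ν a) (hν' : ∀ x ∈ vars B, ν' x = ν x)
    (hH : ∀ a ∈ H, I.Holds ν' a) : I.SatConj Q := by
  classical
  have hdisj : ∀ x, x ∈ vars U.Q' → x ∈ vars U.H' → False := fun x hx hx' =>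
    Set.disjoint_left.1 U.vars_disjoint (vars_mono U.Q'_subset hx)
      (vars_mono (U.H'_subset.trans Set.subset_union_right) hx')
  have hex : ∀ z ∈ vars U.H' \ vars B, ∀ t, U.P.Rel (.var z) t → t ≠ .var z →
      ∃ x ∈ vars U.Q' \ vars (Q \ U.Q'), t = .var x := by
    rintro z hz t ⟨C, hC, hzC, htC⟩ hne
    exact U.existential C hC z hz hzC t htC hne
  -- `g` corrects `ν` only on variables glued to an existential variable `z`, which take the witness
  -- `ν' z`.
  let g : X → I.Dom := fun x =>
    if h : ∃ z ∈ vars U.H' \ vars B, U.P.Rel (.var z) (.var x) then ν' h.choose else ν x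
  have key : ∀ s ∈ terms U.Q', ∀ t ∈ terms U.H', U.P.Rel s t → I.eval g s = I.eval ν' t := by
    intro s hs t ht hst
    by_cases hz : ∃ z ∈ vars U.H' \ vars B, t = .var z
    · obtain ⟨z, hz, rfl⟩ := hz
      have hne : s ≠ .var z := by
        rintro rfl
        exact hdisj z hs hz.1
      obtain ⟨x, hx, rfl⟩ := hex z hz s hst.symm hne
      have h : ∃ z ∈ vars U.H' \ vars B, U.P.Rel (.var z) (.var x) := ⟨z, hz, hst.symm⟩
      -- A class holds at most one existential variable: its other terms are variables of the query,
      -- which the rule does not share.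
      have e : h.choose = z := by
        by_contra hc
        obtain ⟨y, hy, hyz⟩ := hex z hz (.var h.choose) (hst.symm.trans h.choose_spec.2.symm)
          (fun h' => hc (Term.var.inj h'))
        exact hdisj y hy.1 (Term.var.inj hyz ▸ h.choose_spec.1.1)
      change g x = ν' z
      simp only [g, dif_pos h, e]
    -- Here `t` is a constant or a frontier variable and no existential variable is in its class, so
    -- both sides reduce to `ν`.
    · have hcls : ∀ z ∈ vars U.H' \ vars B, ¬ U.P.Rel (.var z) t := by
        intro z hz' hrel
        obtain ⟨x, hx, rfl⟩ := hex z hz' t hrel fun h => hz ⟨z, hz', h⟩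
        exact hdisj x hx.1 ht
      have h1 : I.eval g s = I.eval ν s := by
        cases s with
        | const b => rfl
        | var x =>
          have : ¬ ∃ z ∈ vars U.H' \ vars B, U.P.Rel (.var z) (.var x) := by
            rintro ⟨z, hz', hrel⟩
            exact hcls z hz' (hrel.trans hst)
          change g x = ν x
          simp only [g, dif_neg this]
      have h2 : I.eval ν' t = I.eval ν t := by
        cases t with
        | const b => rfl
        | var x =>
          refine hν' x ?_
          by_contra hx
          exact hz ⟨x, ⟨ht, hx⟩, rfl⟩
      rw [h1, h2]
      exact hP _ _ hst
  refine ⟨g, fun a ha => ?_⟩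
  by_cases haQ : a ∈ U.Q'
  · obtain ⟨σ, hσ, hu⟩ := U.unifies
    obtain ⟨b, hb, hab⟩ : a.subst σ ∈ substSet σ U.H' := hu ▸ ⟨a, haQ, rfl⟩
    obtain ⟨p, v⟩ := a
    obtain ⟨q, w⟩ := b
    obtain ⟨rfl, hargs⟩ := Atom.mk.inj hab
    have hargs := congrFun (eq_of_heq hargs)
    have := hH _ (U.H'_subset hb)
    unfold Interp.Holds at this ⊢
    convert this using 2 with k
    have hs : v k ∈ terms U.Q' := ⟨_, haQ, k, rfl⟩
    have ht : w k ∈ terms U.H' := ⟨_, hb, k, rfl⟩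
    -- Terms with the same image under an associated substitution lie in the same class.
    exact key _ hs _ ht ((hσ.apply_eq_apply_iff_rel (Or.inl hs)).1 (hargs k).symm)
  -- Variables of the remaining part are never glued to an existential variable, so `g` agrees with
  -- `ν` on them.
  · refine (hQ a ⟨ha, haQ⟩).congr (S := Q \ U.Q') ⟨ha, haQ⟩ fun x hx => ?_
    have : ¬ ∃ z ∈ vars U.H' \ vars B, U.P.Rel (.var z) (.var x) := by
      rintro ⟨z, hz, hrel⟩
      by_cases hxz : x = z
      · subst hxz
        exact Set.disjoint_left.1 U.vars_disjoint (vars_mono Set.sdiff_subset hx)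
          (vars_mono (U.H'_subset.trans Set.subset_union_right) hz.1)
      · obtain ⟨y, hy, hxy⟩ := hex z hz _ hrel fun h => hxz (Term.var.inj h)
        exact hy.2 (Term.var.inj hxy ▸ hx)
    simp only [g, dif_neg this]

theorem satUnion_of_produced {𝒬 : Set (Set (Atom 𝒱 X))} {ℛ : Set (Rule 𝒱 X)} {I : Interp 𝒱}
    (hℛ : ∀ R ∈ ℛ, I.SatRule R) (h : I.SatUnion (produced 𝒬 ℛ)) : I.SatUnion 𝒬 := by
  obtain ⟨_, ⟨R, hR, μ, σ, hσ, rfl⟩, ν, hν⟩ := h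
  have hP : ∀ i s t, (μ.unifier i).P.Rel s t →
      I.eval (fun x => I.eval ν (σ x)) s = I.eval (fun x => I.eval ν (σ x)) t := by
    intro i s t hst
    have hst : (join fun i => (μ.unifier i).P).Rel s t := join_rel.2 (.single ⟨i, hst⟩)
    rw [← I.eval_subst, ← I.eval_subst, hσ.apply_eq_apply hst]
  obtain ⟨i, ν', hν', hH⟩ := hℛ R hR (fun x => I.eval ν (σ x))
    fun a ha => (I.holds_subst ν σ a).1 (hν _ (Or.inl ⟨a, ha, rfl⟩))
  obtain ⟨Q, hQ, hcopy⟩ := μ.isCopy i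
  refine ⟨Q, hQ, hcopy.satConj ((μ.unifier i).satConj (hP i) (fun a ha => ?_) hν' hH)⟩
  exact (I.holds_subst ν σ a).1 (hν _ (Or.inr (Set.mem_iUnion.2 ⟨i, a, ha, rfl⟩)))

theorem satUnion_of_level {𝒬 : Set (Set (Atom 𝒱 X))} {ℛ : Set (Rule 𝒱 X)} {I : Interp 𝒱}
    (hℛ : ∀ R ∈ ℛ, I.SatRule R) {k : ℕ} (h : I.SatUnion (level 𝒬 ℛ k)) : I.SatUnion 𝒬 := by
  induction k with
  | zero => exact h
  | succ k ih =>
    obtain ⟨Q, hQ | hQ, hI⟩ := h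
    · exact ih ⟨Q, hQ, hI⟩
    · exact ih (satUnion_of_produced hℛ ⟨Q, hQ, hI⟩)

theorem produced_finite {𝒬 : Set (Set (Atom 𝒱 X))} {ℛ : Set (Rule 𝒱 X)} (h𝒬 : ∀ Q ∈ 𝒬, Q.Finite) :
    ∀ Q ∈ produced 𝒬 ℛ, Q.Finite := by
  rintro _ ⟨R, -, μ, σ, -, rfl⟩
  refine (R.body_finite.image _).union (Set.finite_iUnion fun i => Set.Finite.image _ ?_)
  obtain ⟨Q, hQ, ρ, -, hcopy⟩ := μ.isCopy i
  have hfin : (μ.copy i).Finite := hcopy ▸ (h𝒬 Q hQ).image _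
  exact hfin.subset Set.sdiff_subset

theorem level_finite {𝒬 : Set (Set (Atom 𝒱 X))} {ℛ : Set (Rule 𝒱 X)} (h𝒬 : ∀ Q ∈ 𝒬, Q.Finite)
    (k : ℕ) : ∀ Q ∈ level 𝒬 ℛ k, Q.Finite := by
  induction k with
  | zero => exact h𝒬
  | succ k ih =>
    rintro Q (hQ | hQ)
    · exact ih Q hQ
    · exact produced_finite ih Q hQ

theorem level_mono {𝒬 : Set (Set (Atom 𝒱 X))} {ℛ : Set (Rule 𝒱 X)} : Monotone (level 𝒬 ℛ) :=
  monotone_nat_of_le_succ fun _ => Set.subset_union_left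

end Soundness

/-! ### Completeness: from matches of the head disjuncts to a produced query. -/

section Completeness

variable {𝒱 : Vocabulary.{u, v}} {X : Type w} {D : Type*}

/-- A match `h` of a query in `A` extended with an instance of `H` whose existential variables are
mapped to fresh elements, but not in `A` alone, gives rise to a piece-unifier. -/
theorem exists_pieceUnifier {c : 𝒱.Const → D} (hc : Function.Injective c) {A : Set (Fact 𝒱 D)}
    {Q B H : Set (Atom 𝒱 X)} (hvars : Disjoint (vars Q) (vars (B ∪ H))) {h : X → D}
    (hB : ∀ a ∈ B, a.fact c h ∈ A)
    (hQ : ∀ a ∈ Q, a.fact c h ∈ A ∨ ∃ b ∈ H, b.fact c h = a.fact c h)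
    (hQA : ∃ a ∈ Q, a.fact c h ∉ A)
    (hfresh : ∀ z ∈ vars H \ vars B, ∀ f ∈ A, ∀ k, f.2 k ≠ h z)
    (hconst : ∀ z ∈ vars H \ vars B, ∀ b, c b ≠ h z)
    (hinj : Set.InjOn h (vars H \ vars B)) :
    ∃ U : PieceUnifier Q B H, (∀ s t, U.P.Rel s t → s.val c h = t.val c h) ∧
      ∀ a ∈ Q \ U.Q', a.fact c h ∈ A := by
  -- The unified part consists of exactly the atoms that need the new facts; the partition
  -- identifies terms with equal values.
  let Q' : Set (Atom 𝒱 X) := {a | a ∈ Q ∧ a.fact c h ∉ A}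
  let H' : Set (Atom 𝒱 X) := {b | b ∈ H ∧ ∃ a ∈ Q', b.fact c h = a.fact c h}
  let P := kernelPartition (Term.val c h) (terms Q' ∪ terms H')
  have hadm : IsAdmissible P := by
    rintro _ ⟨t, -, rfl⟩ a b ha hb
    exact hc (ha.2.trans hb.2.symm)
  have hunif : ∀ σ, IsAssociated P σ → ∀ a b : Atom 𝒱 X, terms {a} ⊆ terms Q' ∪ terms H' →
      terms {b} ⊆ terms Q' ∪ terms H' → a.fact c h = b.fact c h → a.subst σ = b.subst σ := by
    rintro σ hσ ⟨p, v⟩ ⟨q, w⟩ ha hb hab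
    obtain ⟨rfl, hargs⟩ := Sigma.mk.inj hab
    have hargs := congrFun (eq_of_heq hargs)
    simp only [Atom.subst, Atom.mk.injEq, heq_eq_eq, true_and]
    funext k
    exact hσ.apply_eq_apply (kernelPartition_rel.2
      ⟨ha ⟨_, rfl, k, rfl⟩, hb ⟨_, rfl, k, rfl⟩, hargs k⟩)
  have hterms : ∀ {S : Set (Atom 𝒱 X)} {a}, a ∈ S → terms {a} ⊆ terms S := by
    rintro S a ha _ ⟨_, rfl, k, rfl⟩
    exact ⟨_, ha, k, rfl⟩
  refine ⟨⟨Q', H', P, hvars, hQA, fun a ha => ha.1, fun b hb => hb.1, hadm, ?_, ?_⟩, ?_, ?_⟩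
  · obtain ⟨σ, hσ⟩ := hadm.exists_isAssociated
    refine ⟨σ, hσ, Set.Subset.antisymm ?_ ?_⟩
    · rintro _ ⟨a, ha, rfl⟩
      obtain ⟨b, hb, hba⟩ := (hQ a ha.1).resolve_left ha.2
      have hbH : b ∈ H' := ⟨hb, a, ha, hba⟩
      exact ⟨b, hbH, hunif σ hσ b a ((hterms hbH).trans Set.subset_union_right)
        ((hterms ha).trans Set.subset_union_left) hba⟩
    · rintro _ ⟨b, hbH, rfl⟩
      obtain ⟨hb, a, ha, hba⟩ := hbH
      exact ⟨a, ha, (hunif σ hσ b a ((hterms (S := H') ⟨hb, a, ha, hba⟩).trans Set.subset_union_right)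
        ((hterms ha).trans Set.subset_union_left) hba).symm⟩
  · rintro _ ⟨r, -, rfl⟩ z ⟨hzH, hzB⟩ hzC t htC hne
    have hzt : t.val c h = h z := htC.2.trans hzC.2.symm
    have hz : z ∈ vars H \ vars B := ⟨vars_mono (fun b hb => hb.1) hzH, hzB⟩
    cases t with
    | const b => exact absurd hzt (hconst z hz b)
    | var x =>
      refine ⟨x, ⟨?_, ?_⟩, rfl⟩
      · rcases htC.1 with hx | hx
        · exact hx
        · exfalso
          -- A variable of the head with the value of `z` cannot be in the body, by freshness of `h
          -- z`, and if existential it is `z` by injectivity.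
          by_cases hxB : x ∈ vars B
          · obtain ⟨b, hb, k, hk⟩ := hxB
            refine hfresh z hz _ (hB b hb) k ?_
            change (b.args k).val c h = _
            rw [hk, hzt]
          · exact hne (congrArg _ (hinj ⟨vars_mono (fun b hb => hb.1) hx, hxB⟩ hz hzt))
      · rintro ⟨a, ha, k, hk⟩
        have haA : a.fact c h ∈ A := by
          by_contra hA
          exact ha.2 ⟨ha.1, hA⟩
        refine hfresh z hz _ haA k ?_
        change (a.args k).val c h = _
        rw [hk, hzt]
  · exact fun s t hst => (kernelPartition_rel.1 hst).2.2
  · intro a ha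
    by_contra hA
    exact ha.2 ⟨ha.1, hA⟩

/-- If every instance of a head disjunct of an applicable rule, with fresh elements for the
existential variables, makes some query of `𝒬` true, then some query of `𝒬` or a query produced
from `𝒬` is already true. -/
theorem exists_match_of_forall_head [Infinite X] {c : 𝒱.Const → D} (hc : Function.Injective c)
    {A : Set (Fact 𝒱 D)} {𝒬 : Set (Set (Atom 𝒱 X))} (h𝒬 : ∀ Q ∈ 𝒬, Q.Finite)
    {ℛ : Set (Rule 𝒱 X)} {R : Rule 𝒱 X} (hR : R ∈ ℛ) {ν : X → D}
    (hB : ∀ a ∈ R.body, a.fact c ν ∈ A) {η : Fin R.n → X → D}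
    (hη : ∀ i, ∀ x ∈ vars R.body, η i x = ν x)
    (hfresh : ∀ i, ∀ z ∈ vars (R.head i) \ vars R.body, ∀ f ∈ A, ∀ k, f.2 k ≠ η i z)
    (hconst : ∀ i, ∀ z ∈ vars (R.head i) \ vars R.body, ∀ b, c b ≠ η i z)
    (hinj : ∀ i, Set.InjOn (η i) (vars (R.head i) \ vars R.body))
    (hmatch : ∀ i, ∃ Q ∈ 𝒬, ∃ μ : X → D, ∀ a ∈ Q,
      a.fact c μ ∈ A ∪ Atom.fact c (η i) '' R.head i) :
    ∃ Q ∈ 𝒬 ∪ produced 𝒬 ℛ, ∃ μ : X → D, ∀ a ∈ Q, a.fact c μ ∈ A := by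
  -- If nothing matches in `A` yet, every match below uses a new fact, so every unified part is
  -- non-empty.
  by_cases hA : ∃ Q ∈ 𝒬, ∃ μ : X → D, ∀ a ∈ Q, a.fact c μ ∈ A
  · obtain ⟨Q, hQ, h⟩ := hA
    exact ⟨Q, Or.inl hQ, h⟩
  choose Q hQ μ hμ using hmatch
  obtain ⟨Q', hcopy, hQR, hQQ⟩ := exists_copies Q (fun i => h𝒬 _ (hQ i)) R.vars_finite
  choose μ' hμ' using fun i => (hcopy i).exists_assignment c (μ i)
  have hbody : vars R.body ⊆ R.vars := Set.subset_union_left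
  have hhead : ∀ i, vars (R.head i) ⊆ R.vars := fun i =>
    (Set.subset_iUnion (fun i => vars (R.head i)) i).trans Set.subset_union_right
  have hne : Nonempty D := ⟨ν (Classical.arbitrary X)⟩
  -- One assignment for the rule and all copies: overlaps occur only in the body, where all `η i`
  -- equal `ν`.
  obtain ⟨h, hh⟩ := exists_glue
    (Sum.elim (fun i => vars R.body ∪ vars (R.head i)) fun i => vars (Q' i)) (Sum.elim η μ') (by
      have hl : ∀ i, vars R.body ∪ vars (R.head i) ⊆ R.vars := fun i =>
        Set.union_subset hbody (hhead i)
      rintro (i | i) (j | j) x hi hj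
      · by_cases hx : x ∈ vars R.body
        · exact (hη i x hx).trans (hη j x hx).symm
        · by_cases hij : i = j
          · rw [hij]
          · exact absurd ⟨hj.resolve_left hx, hx⟩
              (Set.disjoint_left.1 (R.exist_disjoint i j hij) ⟨hi.resolve_left hx, hx⟩)
      · exact absurd (hl i hi) (Set.disjoint_left.1 (hQR j) hj)
      · exact absurd (hl j hj) (Set.disjoint_left.1 (hQR i) hi)
      · by_cases hij : i = j
        · rw [hij]
        · exact absurd hj (Set.disjoint_left.1 (hQQ i j hij) hi))
  have hhη : ∀ i, ∀ x ∈ vars (R.head i), h x = η i x := fun i x hx => hh (.inl i) x (Or.inr hx)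
  have hhB : ∀ x ∈ vars R.body, h x = ν x := fun x hx =>
    (hh (.inl ⟨0, R.n_pos⟩) x (Or.inl hx)).trans (hη _ x hx)
  have hhQ : ∀ i, ∀ x ∈ vars (Q' i), h x = μ' i x := fun i x hx => hh (.inr i) x hx
  have hBA : ∀ a ∈ R.body, a.fact c h ∈ A := fun a ha => by
    rw [Atom.fact_congr ha hhB]
    exact hB a ha
  have hU : ∀ i, ∃ U : PieceUnifier (Q' i) R.body (R.head i),
      (∀ s t, U.P.Rel s t → s.val c h = t.val c h) ∧ ∀ a ∈ Q' i \ U.Q', a.fact c h ∈ A := by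
    intro i
    refine exists_pieceUnifier hc ?_ hBA ?_ ?_ ?_ ?_ ?_
    · refine (hQR i).mono_right ?_
      rintro x ⟨a, ha | ha, k, hk⟩
      · exact hbody ⟨a, ha, k, hk⟩
      · exact hhead i ⟨a, ha, k, hk⟩
    · intro a' ha'
      obtain ⟨a, ha, haa'⟩ := hμ' i a' ha'
      rw [Atom.fact_congr ha' (hhQ i), haa']
      refine (hμ i a ha).imp_right ?_
      rintro ⟨b, hb, hba⟩
      exact ⟨b, hb, by rw [Atom.fact_congr hb (hhη i), hba]⟩
    · by_contra! hall
      refine hA ⟨Q i, hQ i, ?_⟩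
      have hsat : (factInterp c A).SatConj (Q' i) :=
        ⟨h, fun a ha => factInterp_holds.2 (hall a ha)⟩
      obtain ⟨κ, hκ⟩ := (hcopy i).satConj hsat
      exact ⟨κ, fun a ha => factInterp_holds.1 (hκ a ha)⟩
    · intro z hz
      rw [hhη i z hz.1]
      exact hfresh i z hz
    · intro z hz
      rw [hhη i z hz.1]
      exact hconst i z hz
    · intro y hy z hz hyz
      rw [hhη i y hy.1, hhη i z hz.1] at hyz
      exact hinj i hy hz hyz
  choose U hUP hUQ using hU
  -- Values under `h` are constant on the classes of each partition, hence of the join. As `c` is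
  -- injective, the join is admissible.
  have hjoin : ∀ s t, (join fun i => (U i).P).Rel s t → s.val c h = t.val c h := fun s t hst =>
    (join_rel.1 hst).eq_of_forall hUP
  let M : DisjPieceUnifier 𝒬 R :=
    { copy := Q'
      isCopy := fun i => ⟨Q i, hQ i, hcopy i⟩
      copy_disjoint_rule := hQR
      copy_disjoint := hQQ
      unifier := U
      admissible := fun C hC a b ha hb => hc (hjoin _ _ ⟨C, hC, ha, hb⟩) }
  obtain ⟨σ, hσ⟩ := M.admissible.exists_isAssociated
  -- Applying `σ` does not change values under `h`, so `h` itself matches the produced query.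
  have hval : ∀ x, (σ x).val c h = h x := by
    intro x
    by_cases hx : Term.var x ∈ ⋃ i, (terms (U i).Q' ∪ terms (U i).H')
    · exact (hjoin _ _ (hσ.rel_apply hx)).symm
    · have : σ x = .var x := hσ.apply_of_notMem hx
      rw [this]
      rfl
  have hfact : ∀ a : Atom 𝒱 X, (a.subst σ).fact c h = a.fact c h := by
    intro a
    rw [Atom.fact_subst, funext hval]
  refine ⟨M.produce σ, Or.inr ⟨R, hR, M, σ, hσ, rfl⟩, h, ?_⟩
  rintro _ (⟨a, ha, rfl⟩ | hmem)
  · rw [hfact]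
    exact hBA a ha
  · obtain ⟨i, a, ha, rfl⟩ := Set.mem_iUnion.1 hmem
    rw [hfact]
    exact hUQ i a ha

/-! ### Countermodels over constants, variables and nulls. -/

/-- The domain of the models built from fact bases: constants, variables of the fact base, and a
null for each existential variable of each instance of a disjunct of the head of a rule. -/
inductive Skolem (𝒱 : Vocabulary.{u, v}) (X : Type w) : Type (max u v w)
  | const (c : 𝒱.Const) : Skolem 𝒱 X
  | var (x : X) : Skolem 𝒱 X
  | null (R : Rule 𝒱 X) (i : Fin R.n) (z : X) (ν : X → Skolem 𝒱 X) : Skolem 𝒱 X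

open Classical in
/-- The extension of the assignment `ν` of the variables of the body of `R` that maps the
existential variables of the `i`-th disjunct of the head to their nulls. -/
noncomputable def skolemize (R : Rule 𝒱 X) (i : Fin R.n) (ν : X → Skolem 𝒱 X) (x : X) :
    Skolem 𝒱 X :=
  if x ∈ vars R.body then ν x else .null R i x ν

theorem skolemize_of_mem {R : Rule 𝒱 X} {i : Fin R.n} {ν : X → Skolem 𝒱 X} {x : X}
    (hx : x ∈ vars R.body) : skolemize R i ν x = ν x :=
  if_pos hx

theorem skolemize_of_notMem {R : Rule 𝒱 X} {i : Fin R.n} {ν : X → Skolem 𝒱 X} {x : X}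
    (hx : x ∉ vars R.body) : skolemize R i ν x = .null R i x ν :=
  if_neg hx

/-- The facts of a fact base, over the domain of constants, variables and nulls. -/
def baseFacts (F : Set (Atom 𝒱 X)) : Set (Fact 𝒱 (Skolem 𝒱 X)) :=
  Atom.fact Skolem.const Skolem.var '' F

theorem satConj_of_match {F Q : Set (Atom 𝒱 X)} {μ : X → Skolem 𝒱 X}
    (h : ∀ a ∈ Q, a.fact Skolem.const μ ∈ baseFacts F) {I : Interp 𝒱} (hI : I.SatConj F) :
    I.SatConj Q := by
  obtain ⟨ν, hν⟩ := hI
  have := I.nonempty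
  let g : Skolem 𝒱 X → I.Dom
    | .const b => I.const b
    | .var x => ν x
    -- An arbitrary value suffices, since no null occurs in `baseFacts F`.
    | .null _ _ _ _ => Classical.arbitrary _
  refine ⟨fun x => g (μ x), fun a ha => ?_⟩
  obtain ⟨b, hb, hba⟩ := h a ha
  have hb := hν b hb
  obtain ⟨p, v⟩ := a
  obtain ⟨q, w⟩ := b
  obtain ⟨rfl, hargs⟩ := Sigma.mk.inj hba
  have hargs := congrFun (eq_of_heq hargs)
  unfold Interp.Holds at hb ⊢
  convert hb using 2 with k
  have e1 : ∀ t : Term 𝒱 X, I.eval (fun x => g (μ x)) t = g (t.val Skolem.const μ) := by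
    rintro (_ | _) <;> rfl
  have e2 : ∀ t : Term 𝒱 X, I.eval ν t = g (t.val Skolem.const Skolem.var) := by
    rintro (_ | _) <;> rfl
  rw [e1, e2]
  exact congrArg g (hargs k).symm

theorem exists_match_of_satUnion {D : Type*} [Nonempty D] {c : 𝒱.Const → D} {A : Set (Fact 𝒱 D)}
    {𝒬 : Set (Set (Atom 𝒱 X))} (h : (factInterp c A).SatUnion 𝒬) :
    ∃ Q ∈ 𝒬, ∃ μ : X → D, ∀ a ∈ Q, a.fact c μ ∈ A := by
  obtain ⟨Q, hQ, μ, hμ⟩ := h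
  exact ⟨Q, hQ, μ, fun a ha => factInterp_holds.1 (hμ a ha)⟩

theorem factInterp_satConj [Nonempty (Skolem 𝒱 X)] {F : Set (Atom 𝒱 X)}
    {A : Set (Fact 𝒱 (Skolem 𝒱 X))} (h : baseFacts F ⊆ A) :
    (factInterp Skolem.const A).SatConj F :=
  ⟨Skolem.var, fun a ha => factInterp_holds.2 (h ⟨a, ha, rfl⟩)⟩

/-- An entailed union of conjunctive queries has a disjunct that is true in all the models of the
facts, over domains in any universe. -/
theorem Entails.exists_satConj [Nonempty X] {F : Set (Atom 𝒱 X)} {𝒬 : Set (Set (Atom 𝒱 X))}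
    (h : Entails F 𝒬) : ∃ Q ∈ 𝒬, ∀ I : Interp 𝒱, I.SatConj F → I.SatConj Q := by
  have : Nonempty (Skolem 𝒱 X) := ⟨.var (Classical.arbitrary X)⟩
  obtain ⟨Q, hQ, μ, hμ⟩ :=
    exists_match_of_satUnion (h _ (factInterp_satConj (Set.Subset.refl (baseFacts F))))
  exact ⟨Q, hQ, fun I hI => satConj_of_match hμ hI⟩

/-- The sets of facts that make no query of `𝒬` true and contain, with a null, the whole instance
of the disjunct that introduces it. -/
def Countermodels (𝒬 : Set (Set (Atom 𝒱 X))) : Set (Set (Fact 𝒱 (Skolem 𝒱 X))) :=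
  {A | (¬ ∃ Q ∈ 𝒬, ∃ μ : X → Skolem 𝒱 X, ∀ a ∈ Q, a.fact Skolem.const μ ∈ A) ∧
    ∀ f ∈ A, ∀ k R i z ν, f.2 k = .null R i z ν →
      ∀ a ∈ R.head i, a.fact Skolem.const (skolemize R i ν) ∈ A}

/-- A match of a finite query in the union of a chain already lies in one member. -/
theorem sUnion_mem_countermodels {𝒬 : Set (Set (Atom 𝒱 X))} (h𝒬 : ∀ Q ∈ 𝒬, Q.Finite)
    {𝒞 : Set (Set (Fact 𝒱 (Skolem 𝒱 X)))} (h𝒞 : 𝒞 ⊆ Countermodels 𝒬)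
    (hchain : IsChain (· ⊆ ·) 𝒞) (hne : 𝒞.Nonempty) : ⋃₀ 𝒞 ∈ Countermodels 𝒬 := by
  constructor
  · rintro ⟨Q, hQ, μ, hμ⟩
    obtain ⟨A, hA, hQA⟩ := DirectedOn.exists_mem_subset_of_finite_of_subset_sUnion hne
      hchain.directedOn ((h𝒬 Q hQ).image (Atom.fact Skolem.const μ))
      (Set.image_subset_iff.2 hμ)
    exact (h𝒞 hA).1 ⟨Q, hQ, μ, fun a ha => hQA ⟨a, ha, rfl⟩⟩
  · rintro f ⟨A, hA, hf⟩ k R i z ν hk a ha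
    exact ⟨A, hA, (h𝒞 hA).2 f hf k R i z ν hk a ha⟩

theorem exists_level_of_forall_W {𝒬 : Set (Set (Atom 𝒱 X))} {ℛ : Set (Rule 𝒱 X)} {ι : Type*}
    [Finite ι] {Q : ι → Set (Atom 𝒱 X)} (hQ : ∀ i, Q i ∈ W 𝒬 ℛ) :
    ∃ k, ∀ i, Q i ∈ level 𝒬 ℛ k := by
  choose m hm using fun i => Set.mem_iUnion.1 (hQ i)
  obtain ⟨k, hk⟩ := (Set.finite_range m).bddAbove
  exact ⟨k, fun i => level_mono (hk ⟨i, rfl⟩) (hm i)⟩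

/-- A maximal set of facts without matches of queries of `W` satisfies the rules. -/
theorem satRule_of_maximal [Infinite X] [Nonempty (Skolem 𝒱 X)] {𝒬 : Set (Set (Atom 𝒱 X))}
    (h𝒬 : ∀ Q ∈ 𝒬, Q.Finite) {ℛ : Set (Rule 𝒱 X)} {A : Set (Fact 𝒱 (Skolem 𝒱 X))}
    (hA : Maximal (· ∈ Countermodels (W 𝒬 ℛ)) A) {R : Rule 𝒱 X} (hR : R ∈ ℛ) :
    (factInterp Skolem.const A).SatRule R := by
  intro (ν : X → Skolem 𝒱 X) hν
  have hB : ∀ a ∈ R.body, a.fact Skolem.const ν ∈ A := fun a ha => factInterp_holds.1 (hν a ha)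
  by_contra hno
  have hnot : ∀ i, ¬ ∀ a ∈ R.head i, a.fact Skolem.const (skolemize R i ν) ∈ A :=
    fun i hi => hno ⟨i, skolemize R i ν, fun x hx => skolemize_of_mem hx,
      fun a ha => factInterp_holds.2 (hi a ha)⟩
  have hmatch : ∀ i, ∃ Q ∈ W 𝒬 ℛ, ∃ μ : X → Skolem 𝒱 X, ∀ a ∈ Q,
      a.fact Skolem.const μ ∈ A ∪ Atom.fact Skolem.const (skolemize R i ν) '' R.head i := by
    intro i
    by_contra hi
    -- The enlarged set keeps the condition on nulls: a null in the new instance either comes from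
    -- the body, so occurs in `A`, or is introduced by this very instance.
    refine hnot i fun a ha => hA.le_of_ge (y := A ∪ _) ⟨hi, ?_⟩ Set.subset_union_left
      (Or.inr ⟨a, ha, rfl⟩)
    rintro f (hf | ⟨b, hb, rfl⟩) k R' i' z ν' hk a ha
    · exact Or.inl (hA.1.2 f hf k R' i' z ν' hk a ha)
    change (b.args k).val _ _ = _ at hk
    cases hbk : b.args k with
    | const e => simp [hbk, Term.val] at hk
    | var x =>
      rw [hbk] at hk
      change skolemize R i ν x = _ at hk
      by_cases hx : x ∈ vars R.body
      · rw [skolemize_of_mem hx] at hk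
        obtain ⟨e, he, l, hl⟩ := hx
        refine Or.inl (hA.1.2 _ (hB e he) l R' i' z ν' ?_ a ha)
        change (e.args l).val _ _ = _
        rw [hl]
        exact hk
      · rw [skolemize_of_notMem hx] at hk
        cases hk
        exact Or.inr ⟨a, ha, rfl⟩
  choose Q hQ hQμ using hmatch
  obtain ⟨k, hk⟩ := exists_level_of_forall_W hQ
  obtain ⟨Q, hQ, hμ⟩ := exists_match_of_forall_head (𝒬 := level 𝒬 ℛ k) (c := Skolem.const)
    (fun _ _ h => Skolem.const.inj h) (level_finite h𝒬 k) hR hB (η := fun i => skolemize R i ν)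
    (fun i x hx => skolemize_of_mem hx)
    -- If the null occurred in `A`, so would its whole head instance.
    (fun i z hz f hf l hl => hnot i
      (hA.1.2 f hf l R i z ν (hl.trans (skolemize_of_notMem hz.2))))
    (fun i z hz b hb => by simp [skolemize_of_notMem hz.2] at hb)
    (fun i y hy z hz hyz => by
      simpa [skolemize_of_notMem hy.2, skolemize_of_notMem hz.2] using hyz)
    (fun i => ⟨Q i, hk i, hQμ i⟩)
  exact hA.1.1 ⟨Q, Set.mem_iUnion.2 ⟨k + 1, hQ⟩, hμ⟩

theorem exists_match_of_kbEntails [Infinite X] {𝒬 : Set (Set (Atom 𝒱 X))}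
    (h𝒬 : ∀ Q ∈ 𝒬, Q.Finite) {ℛ : Set (Rule 𝒱 X)} {F : Set (Atom 𝒱 X)}
    (h : KBEntails F ℛ 𝒬) : ∃ Q ∈ W 𝒬 ℛ, ∃ μ : X → Skolem 𝒱 X,
      ∀ a ∈ Q, a.fact Skolem.const μ ∈ baseFacts F := by
  by_contra hno
  have : Nonempty (Skolem 𝒱 X) := ⟨.var (Classical.arbitrary X)⟩
  have hF : baseFacts F ∈ Countermodels (W 𝒬 ℛ) := by
    refine ⟨hno, ?_⟩
    rintro _ ⟨b, -, rfl⟩ k R i z ν hk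
    change (b.args k).val _ _ = _ at hk
    cases hbk : b.args k <;> simp [hbk, Term.val] at hk
  have hW : ∀ Q ∈ W 𝒬 ℛ, Q.Finite := fun Q hQ => by
    obtain ⟨k, hk⟩ := Set.mem_iUnion.1 hQ
    exact level_finite h𝒬 k Q hk
  obtain ⟨A, hFA, hA⟩ := zorn_subset_nonempty (Countermodels (W 𝒬 ℛ))
    (fun 𝒞 h𝒞 hchain hne => ⟨⋃₀ 𝒞, sUnion_mem_countermodels hW h𝒞 hchain hne,
      fun _ => Set.subset_sUnion_of_mem⟩) _ hF
  obtain ⟨Q, hQ, hμ⟩ := exists_match_of_satUnion (h _ (factInterp_satConj hFA)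
    fun R hR => satRule_of_maximal h𝒬 hA hR)
  exact hA.1.1 ⟨Q, Set.mem_iUnion.2 ⟨0, hQ⟩, hμ⟩

theorem isCompleteRewriting_W [Infinite X] {𝒬 : Set (Set (Atom 𝒱 X))} (h𝒬 : IsUCQ 𝒬)
    (ℛ : Set (Rule 𝒱 X)) : IsCompleteRewriting (W 𝒬 ℛ) 𝒬 ℛ := by
  refine ⟨⟨fun Q hQ => ?_, fun F _ h I hI hℛ => ?_⟩, fun F _ h I hI => ?_⟩
  · obtain ⟨k, hk⟩ := Set.mem_iUnion.1 hQ
    exact level_finite h𝒬.2 k Q hk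
  · obtain ⟨Q, hQ, hIQ⟩ := h I hI
    obtain ⟨k, hk⟩ := Set.mem_iUnion.1 hQ
    exact satUnion_of_level hℛ ⟨Q, hk, hIQ⟩
  · obtain ⟨Q, hQ, μ, hμ⟩ := exists_match_of_kbEntails h𝒬.2 h
    exact ⟨Q, hQ, satConj_of_match hμ hI⟩

/-! ### Finite rewritings are reached at some level. -/

theorem entails_of_mem {Q : Set (Atom 𝒱 X)} {𝒬 : Set (Set (Atom 𝒱 X))} (h : Q ∈ 𝒬) :
    Entails Q 𝒬 :=
  fun _ hI => ⟨Q, h, hI⟩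

theorem IsUCQRewriting.exists_equivalent_level [Infinite X] {𝒬 𝒬' : Set (Set (Atom 𝒱 X))}
    (h𝒬 : IsUCQ 𝒬) {ℛ : Set (Rule 𝒱 X)} (h : IsUCQRewriting 𝒬' 𝒬 ℛ) :
    ∃ k, Equivalent 𝒬' (level 𝒬 ℛ k) := by
  obtain ⟨hfin, ⟨hCQ, hsound⟩, hcomplete⟩ := h
  obtain ⟨⟨hWfin, hWsound⟩, hWcomplete⟩ := isCompleteRewriting_W h𝒬 ℛ
  have : Finite 𝒬' := hfin
  -- Each CQ of `𝒬'` is used as a fact base: soundness of `𝒬'` and completeness of `W` apply to it.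
  -- The converse below exchanges the two rewritings.
  have h1 : ∀ Q : 𝒬', ∃ Q' ∈ W 𝒬 ℛ, ∀ I : Interp 𝒱, I.SatConj (Q : Set (Atom 𝒱 X)) →
      I.SatConj Q' := fun Q =>
    (hWcomplete _ (hCQ _ Q.2) (hsound _ (hCQ _ Q.2) (entails_of_mem Q.2))).exists_satConj
  choose f hf hfI using h1
  obtain ⟨k, hk⟩ := exists_level_of_forall_W hf
  refine ⟨k, fun I => ⟨?_, ?_⟩⟩
  · rintro ⟨Q, hQ, hI⟩
    exact ⟨_, hk ⟨Q, hQ⟩, hfI ⟨Q, hQ⟩ I hI⟩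
  · rintro ⟨Q, hQ, hI⟩
    have hQW : Q ∈ W 𝒬 ℛ := Set.mem_iUnion.2 ⟨k, hQ⟩
    obtain ⟨Q', hQ', h'⟩ := (hcomplete _ (hWfin _ hQW)
      (hWsound _ (hWfin _ hQW) (entails_of_mem hQW))).exists_satConj
    exact ⟨Q', hQ', h' I hI⟩

end Completeness

end DisjRewriting

theorem proposition1 (𝒱 : Vocabulary.{u, v}) (X : Type w) [Infinite X]
    (𝒬 : Set (Set (DisjRewriting.Atom 𝒱 X))) (h𝒬 : DisjRewriting.IsUCQ 𝒬)
    (ℛ : Set (DisjRewriting.Rule 𝒱 X)) :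
    DisjRewriting.IsCompleteRewriting (DisjRewriting.W 𝒬 ℛ) 𝒬 ℛ ∧
      ∀ 𝒬' : Set (Set (DisjRewriting.Atom 𝒱 X)), DisjRewriting.IsUCQRewriting 𝒬' 𝒬 ℛ →
        ∃ i : ℕ, DisjRewriting.Equivalent 𝒬' (DisjRewriting.level 𝒬 ℛ i) :=
  ⟨DisjRewriting.isCompleteRewriting_W h𝒬 ℛ, fun _ h => h.exists_equivalent_level h𝒬⟩
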